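/- Conventions. A gamble on a non-empty set $\Omega$ is a bounded map $\Omega\to\mathbb R$; $\mathcal L(\Omega)$ is the linear space of all gambles on $\Omega$. A real functional $\underline P$ on a linear space $\mathcal K\subseteq\mathcal L(\Omega)$ is a coherent lower prevision if $\underline P(f)\ge\inf f$, $\underline P(\lambda f)=\lambda\underline P(f)$ and $\underline P(f+g)\ge\underline P(f)+\underline P(g)$ for all $f,g\in\mathcal K$ and all real $\lambda\ge0$. Let $\mathcal X$ be a non-empty finite set, let $\Sigma=\{\theta\in\mathbb R^{\mathcal X}:\theta_x\ge0\text{ for all }x,\ \sum_{x}\theta_x=1\}$, and for $n\ge1$ let $\mathcal N^n=\{m\in\mathbb Z_{\ge0}^{\mathcal X}:\sum_x m_x=n\}$ and let $T^n:\mathcal X^n\to\mathcal N^n$ be the counting map, $T^n_x(z)=|\{k:z_k=x\}|$. For $\theta\in\Sigma$, $f\in\mathcal L(\mathcal X^n)$ and $g\in\mathcal L(\mathcal N^n)$ put $$Mn^n(f|\theta)=\sum_{z\in\mathcal X^n}f(z)\prod_{x}\theta_x^{T^n_x(z)},\qquad CoMn^n(g|\theta)=\sum_{m\in\mathcal N^n}g(m)\,\frac{n!}{\prod_x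 m_x!}\prod_{x}\theta_x^{m_x}.$$ Let $\mathcal V(\Sigma)$ be the linear space of all polynomial functions on $\Sigma$, and $\mathcal C(\Sigma)$ the linear space of all continuous gambles on $\Sigma$. An exchangeable sequence $X_1,X_2,\dots$ in $\mathcal X$ is described by coherent lower previsions $\underline P^n$ on $\mathcal L(\mathcal X^n)$, $n\ge1$ (the distributions of $(X_1,\dots,X_n)$), that are exchangeable, that is, $\underline P^n(\pi f-f)\ge0$ for every gamble $f$ on $\mathcal X^n$ and every permutation $\pi$ of $\{1,\dots,n\}$, where $(\pi f)(z)=f(z_{\pi(1)},\dots,z_{\pi(n)})$, and that are time consistent, that is, $\underline P^n(f)=\underline P^{N}(\tilde f)$ for all $1\le n\le N$ and all gambles $f$ on $\mathcal X^n$, where $\tilde f(z_1,\dots,z_N)=f(z_1,\dots,z_n)$. The distribution of $T^n(X_1,\dots,X_n)$ is given by $\underline Q^n(g)=\underline P^n(g\circ T^n)$ for $g\in\mathcal L(\mathcal N^n)$, and the distribution of the frequency random variable $F_n=T^n(X_1,\dots,X_n)/n$, which takes values in $\Sigma$, is given by $\underline P_{F_n}(h)=\underline P^n(h\circ (T^n/n))$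 for $h\in\mathcal L(\Sigma)$. Theorem. For every such family there is a unique coherent lower prevision $\underline R$ on $\mathcal V(\Sigma)$ (the representing lower prevision) with $$\underline P^n(f)=\underline R(Mn^n(f|\cdot))\quad\text{and}\quad \underline Q^n(g)=\underline R(CoMn^n(g|\cdot))$$ for all $n\ge1$, $f\in\mathcal L(\mathcal X^n)$ and $g\in\mathcal L(\mathcal N^n)$. It has a unique extension to a coherent lower prevision on $\mathcal C(\Sigma)$, again denoted by $\underline R$, and for all $h\in\mathcal C(\Sigma)$, $$\lim_{n\to\infty}\underline P_{F_n}(h)=\underline R(h).$$ -/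

import Mathlib

open Filter Topology

noncomputable section

namespace LowerPrevision

/-! ### Gambles and coherent lower previsions -/

/-- `gambles Ω` is the linear space `𝓛(Ω)` of all gambles (bounded real functions) on `Ω`. -/
def gambles (Ω : Type*) : Submodule ℝ (Ω → ℝ) where
  carrier := {f | ∃ C : ℝ, ∀ ω, |f ω| ≤ C}
  zero_mem' := ⟨0, fun ω => by simp⟩
  add_mem' := by
    rintro f g ⟨C, hC⟩ ⟨D, hD⟩
    exact ⟨C + D, fun ω => (abs_add_le (f ω) (g ω)).trans (add_le_add (hC ω) (hD ω))⟩
  smul_mem' := by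
    rintro c f ⟨C, hC⟩
    refine ⟨|c| * C, fun ω => ?_⟩
    simpa [abs_mul] using mul_le_mul_of_nonneg_left (hC ω) (abs_nonneg c)

/-- The gamble `h ∘ φ` on `Ω`, for a gamble `h` on `Ω'` and a map `φ : Ω → Ω'`. -/
def pullback {Ω Ω' : Type*} (φ : Ω → Ω') (h : gambles Ω') : gambles Ω :=
  ⟨(h : Ω' → ℝ) ∘ φ, h.2.imp fun _ hC ω => hC (φ ω)⟩

/-- A real functional `P` on a linear space `K` of gambles on a non-empty set `Ω` is a coherent
lower prevision: it accepts sure gains, is non-negatively homogeneous, and superadditive. -/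
structure IsCoherent {Ω : Type*} (K : Submodule ℝ (Ω → ℝ)) (P : K → ℝ) : Prop where
  domain_le : K ≤ gambles Ω
  iInf_le : ∀ f : K, (⨅ ω, (f : Ω → ℝ) ω) ≤ P f
  map_smul : ∀ (c : ℝ) (f : K), 0 ≤ c → P (c • f) = c * P f
  le_map_add : ∀ f g : K, P f + P g ≤ P (f + g)

/-- The distribution of the random variable `φ` when the distribution on `Ω` is `P`. -/
def induced {Ω Ω' : Type*} (P : gambles Ω → ℝ) (φ : Ω → Ω') : gambles Ω' → ℝ :=
  fun h => P (pullback φ h)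

/-- `continuousGambles S` is the linear space `𝓒(S)` of all continuous gambles on `S`. -/
def continuousGambles (S : Type*) [TopologicalSpace S] : Submodule ℝ (S → ℝ) where
  carrier := {f | Continuous f ∧ f ∈ gambles S}
  zero_mem' := ⟨continuous_zero, Submodule.zero_mem _⟩
  add_mem' := fun hf hg => ⟨hf.1.add hg.1, Submodule.add_mem _ hf.2 hg.2⟩
  smul_mem' := fun c _ hf => ⟨hf.1.const_smul c, Submodule.smul_mem _ c hf.2⟩

theorem continuousGambles_le (S : Type*) [TopologicalSpace S] :
    continuousGambles S ≤ gambles S :=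
  fun _ hf => hf.2

/-! ### Exchangeability and time consistency -/

/-- Exchangeability of a coherent lower prevision on `𝓛(𝒳ⁿ)`: the subject accepts to exchange
any gamble `f` for the permuted gamble `x ↦ f (x_{π(1)}, …, x_{π(n)})`. -/
def IsExchangeable {X : Type*} {n : ℕ} (P : gambles (Fin n → X) → ℝ) : Prop :=
  ∀ (π : Equiv.Perm (Fin n)) (f : gambles (Fin n → X)),
    0 ≤ P (pullback (fun x : Fin n → X => x ∘ π) f - f)

/-- Time consistency of a family of lower previsions on `𝓛(𝒳ⁿ)`, `n ≥ 1`: the one on `𝓛(𝒳ⁿ)`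
is the marginal, along the first `n` coordinates, of the one on `𝓛(𝒳ᴺ)`, for all `n ≤ N`. -/
def TimeConsistent {X : Type*} (P : ∀ n : ℕ+, gambles (Fin n → X) → ℝ) : Prop :=
  ∀ (n N : ℕ+) (hnN : n ≤ N) (f : gambles (Fin n → X)),
    P n f = P N (pullback (fun (z : Fin N → X) (i : Fin n) => z (Fin.castLE hnN i)) f)

section Finite

/-! ### Polynomial gambles on the simplex -/

variable {X : Type*} [Fintype X]

variable (X) in
/-- The linear space `𝓥(Σ)` of all polynomial gambles on the `𝒳`-simplex: the restrictions to
the simplex of real polynomials in the variables `θₓ`, `x ∈ 𝒳`. -/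
def polynomialGambles : Submodule ℝ (stdSimplex ℝ X → ℝ) where
  carrier := {f | ∃ p : MvPolynomial X ℝ, ∀ θ, f θ = MvPolynomial.eval (θ : X → ℝ) p}
  zero_mem' := ⟨0, fun θ => by simp⟩
  add_mem' := by
    rintro f g ⟨p, hp⟩ ⟨q, hq⟩
    exact ⟨p + q, fun θ => by simp [hp θ, hq θ]⟩
  smul_mem' := by
    rintro c f ⟨p, hp⟩
    exact ⟨c • p, fun θ => by simp [hp θ, MvPolynomial.smul_eval]⟩

variable (X) in
theorem polynomialGambles_le : polynomialGambles X ≤ continuousGambles (stdSimplex ℝ X) := by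
  rintro f ⟨p, hp⟩
  have hc : Continuous f := by
    have : f = fun θ : stdSimplex ℝ X => MvPolynomial.eval (θ : X → ℝ) p := funext hp
    rw [this]
    exact (MvPolynomial.continuous_eval p).comp continuous_subtype_val
  have : CompactSpace (stdSimplex ℝ X) :=
    isCompact_iff_compactSpace.1 (isCompact_stdSimplex ℝ X)
  obtain ⟨C, hC⟩ := (isCompact_range hc).isBounded.exists_norm_le
  exact ⟨hc, C, fun ω => hC _ ⟨ω, rfl⟩⟩

variable [DecidableEq X]

/-! ### Count vectors and frequencies -/

/-- The set `𝓝ⁿ` of count vectors: non-negative integer vectors with sum `n`. -/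
abbrev CountVec (X : Type*) [Fintype X] (n : ℕ) : Type _ :=
  {m : X → ℕ // ∑ x, m x = n}

instance CountVec.instFintype (n : ℕ) : Fintype (CountVec X n) :=
  Fintype.subtype (Finset.piAntidiag Finset.univ n) (fun m => by simp [Finset.mem_piAntidiag])

/-- The number of components of `z` that are equal to `x`. -/
def count {n : ℕ} (z : Fin n → X) (x : X) : ℕ :=
  (Finset.univ.filter fun k => z k = x).card

theorem sum_count {n : ℕ} (z : Fin n → X) : ∑ x, count z x = n := by
  have h := Finset.card_eq_sum_card_fiberwise (s := (Finset.univ : Finset (Fin n)))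
    (t := (Finset.univ : Finset X)) (f := z) (fun _ _ => Finset.mem_coe.2 (Finset.mem_univ _))
  simpa [count] using h.symm

/-- The counting map `Tⁿ : 𝒳ⁿ → 𝓝ⁿ`. -/
def countMap (n : ℕ) (z : Fin n → X) : CountVec X n :=
  ⟨count z, sum_count z⟩

/-- For a count vector `m ∈ 𝓝ⁿ`, `n ≥ 1`, the vector `m / n` of relative frequencies, a point
of the `𝒳`-simplex. -/
def CountVec.freq {n : ℕ+} (m : CountVec X n) : stdSimplex ℝ X :=
  ⟨fun x => (m.1 x : ℝ) / (n : ℕ), fun x => by positivity, by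
    have hn : ((n : ℕ) : ℝ) ≠ 0 := by exact_mod_cast n.pos.ne'
    rw [← Finset.sum_div, ← Nat.cast_sum, m.2, div_self hn]⟩

/-- The frequency random variable `Fₙ = Tⁿ(X₁, …, Xₙ) / n`, as a map `𝒳ⁿ → Σ`. -/
def frequency (n : ℕ+) (z : Fin n → X) : stdSimplex ℝ X :=
  (countMap n z).freq

/-! ### Multinomial previsions -/

/-- The multinomial prevision: the expectation `Mnⁿ(f|θ)` of `f (Y₁, …, Yₙ)` for independent
`Yₖ` with common mass function `θ`. -/
def multinomialPrev {n : ℕ} (f : gambles (Fin n → X)) (θ : stdSimplex ℝ X) : ℝ :=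
  ∑ z : Fin n → X, (f : (Fin n → X) → ℝ) z * ∏ x, (θ : X → ℝ) x ^ count z x

/-- The count multinomial prevision
`CoMnⁿ(g|θ) = ∑ₘ g(m) (n! / ∏ₓ mₓ!) ∏ₓ θₓ ^ mₓ`. -/
def countMultinomialPrev {n : ℕ} (g : gambles (CountVec X n)) (θ : stdSimplex ℝ X) : ℝ :=
  ∑ m : CountVec X n, (g : CountVec X n → ℝ) m *
    ((Nat.multinomial Finset.univ m.1 : ℝ) * ∏ x, (θ : X → ℝ) x ^ m.1 x)

theorem multinomialPrev_mem {n : ℕ} (f : gambles (Fin n → X)) :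
    multinomialPrev f ∈ polynomialGambles X :=
  ⟨∑ z : Fin n → X, MvPolynomial.C ((f : (Fin n → X) → ℝ) z) *
      ∏ x, MvPolynomial.X x ^ count z x,
    fun θ => by simp [multinomialPrev, map_sum, map_prod]⟩

theorem countMultinomialPrev_mem {n : ℕ} (g : gambles (CountVec X n)) :
    countMultinomialPrev g ∈ polynomialGambles X :=
  ⟨∑ m : CountVec X n, MvPolynomial.C ((g : CountVec X n → ℝ) m) *
      (MvPolynomial.C (Nat.multinomial Finset.univ m.1 : ℝ) *
        ∏ x, MvPolynomial.X x ^ m.1 x),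
    fun θ => by simp [countMultinomialPrev, map_sum, map_prod]⟩

/-! ### Representing lower previsions -/

/-- `R` is a representing coherent lower prevision on `𝓥(Σ)` for the family `Pⁿ` with count
distributions `Qⁿ`: one has `Pⁿ(f) = R(Mnⁿ(f|·))` and `Qⁿ(g) = R(CoMnⁿ(g|·))`. -/
structure IsRepresentation (P : ∀ n : ℕ+, gambles (Fin n → X) → ℝ)
    (R : polynomialGambles X → ℝ) : Prop where
  coherent : IsCoherent (polynomialGambles X) R
  eq_multinomial : ∀ (n : ℕ+) (f : gambles (Fin n → X)),
    P n f = R ⟨multinomialPrev f, multinomialPrev_mem f⟩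
  eq_countMultinomial : ∀ (n : ℕ+) (g : gambles (CountVec X n)),
    induced (P n) (countMap n) g = R ⟨countMultinomialPrev g, countMultinomialPrev_mem g⟩

/-- `E` is a coherent lower prevision on `𝓒(Σ)` that extends `R` from `𝓥(Σ)`. -/
structure IsCoherentExtension (R : polynomialGambles X → ℝ)
    (E : continuousGambles (stdSimplex ℝ X) → ℝ) : Prop where
  coherent : IsCoherent (continuousGambles (stdSimplex ℝ X)) E
  extend : ∀ p : polynomialGambles X, E ⟨p.1, polynomialGambles_le X p.2⟩ = R p

end Finite

end LowerPrevision

end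

noncomputable section

namespace LowerPrevision

/-! ### Consequences of coherence -/

section Coherence

variable {Ω : Type*} {K : Submodule ℝ (Ω → ℝ)} {P : K → ℝ}

/-! The representing lower prevision is the limit of the frequency distributions. At the frequency
vector of `z` in `X^N`, the value `Mn^n(f|·)` is the average of `f (z ∘ τ)` over all maps `τ : Fin n
→ Fin N`, that is, sampling `n` times with replacement (`multinomialPrev_frequency`). By
exchangeability every injective `τ` is as good as the first `n` coordinates, whose lower prevision
is `P n f` by time consistency. The proportion of non-injective `τ` tends to 0, so the distribution
of `F_N` sends `Mn^n(f|·)` to values converging to `P n f`.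

Every polynomial on the simplex is some `Mn^n(f|·)` (`exists_multinomialPrev_eq`), polynomials are
uniformly dense in the continuous gambles, and coherent lower previsions are 1-Lipschitz in the sup
norm. Hence the limit exists on all continuous gambles; it is coherent, and it restricts to `R`. The
same two facts, surjectivity and density, give both uniqueness claims. -/

theorem IsCoherent.le_of_forall_le [Nonempty Ω] (hP : IsCoherent K P) {c : ℝ} {f : K}
    (h : ∀ ω, c ≤ (f : Ω → ℝ) ω) : c ≤ P f :=
  (le_ciInf h).trans (hP.iInf_le f)

theorem IsCoherent.map_add_map_sub_le (hP : IsCoherent K P) (f g : K) :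
    P f + P (g - f) ≤ P g := by
  simpa using hP.le_map_add f (g - f)

theorem IsCoherent.le_add_of_forall_le [Nonempty Ω] (hP : IsCoherent K P) {f g : K} {ε : ℝ}
    (h : ∀ ω, (f : Ω → ℝ) ω ≤ (g : Ω → ℝ) ω + ε) : P f ≤ P g + ε := by
  have h1 : -ε ≤ P (g - f) := hP.le_of_forall_le fun ω => by
    have := h ω
    simp only [Submodule.coe_sub, Pi.sub_apply]
    linarith
  linarith [hP.map_add_map_sub_le f g]

/-- This Lipschitz bound carries uniform polynomial approximation over to previsions, uniformly in
the prevision. -/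
theorem IsCoherent.abs_sub_le [Nonempty Ω] (hP : IsCoherent K P) {f g : K} {ε : ℝ}
    (h : ∀ ω, |(f : Ω → ℝ) ω - (g : Ω → ℝ) ω| ≤ ε) : |P f - P g| ≤ ε := by
  rw [abs_sub_le_iff]
  constructor
  · linarith [hP.le_add_of_forall_le (f := f) (g := g) (ε := ε)
      fun ω => by linarith [(abs_sub_le_iff.1 (h ω)).1]]
  · linarith [hP.le_add_of_forall_le (f := g) (g := f) (ε := ε)
      fun ω => by linarith [(abs_sub_le_iff.1 (h ω)).2]]

theorem IsCoherent.map_zero (hP : IsCoherent K P) : P 0 = 0 := by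
  simpa using hP.map_smul 0 0 le_rfl

theorem IsCoherent.sum_le_map_sum (hP : IsCoherent K P) {ι : Type*} (s : Finset ι) (f : ι → K) :
    ∑ i ∈ s, P (f i) ≤ P (∑ i ∈ s, f i) := by
  classical
  induction s using Finset.induction_on with
  | empty => simp [hP.map_zero]
  | insert a s ha ih =>
    rw [Finset.sum_insert ha, Finset.sum_insert ha]
    linarith [hP.le_map_add (f a) (∑ i ∈ s, f i)]

/-- A coherent lower prevision can be pulled back along any linear map that does not decrease
infima. -/
theorem IsCoherent.comp_linearMap {Ω' : Type*} [Nonempty Ω] {K' : Submodule ℝ (Ω' → ℝ)}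
    (hP : IsCoherent K P)
    (hK' : K' ≤ gambles Ω') (L : K' →ₗ[ℝ] K) (hL : ∀ (f : K') ω, ∃ ω', (f : Ω' → ℝ) ω' =
      (L f : Ω → ℝ) ω) : IsCoherent K' (fun f => P (L f)) where
  domain_le := hK'
  iInf_le f := hP.le_of_forall_le fun ω => by
    obtain ⟨ω', h⟩ := hL f ω
    obtain ⟨C, hC⟩ := hK' f.2
    rw [← h]
    exact ciInf_le ⟨-C, by rintro _ ⟨x, rfl⟩; exact (abs_le.1 (hC x)).1⟩ ω'
  map_smul c f hc := by rw [_root_.map_smul, hP.map_smul c _ hc]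
  le_map_add f g := by rw [_root_.map_add]; exact hP.le_map_add _ _

/-- The pullback of gambles along a map, as a linear map. -/
def pullbackLinear {Ω' : Type*} (φ : Ω → Ω') : gambles Ω' →ₗ[ℝ] gambles Ω where
  toFun := pullback φ
  map_add' _ _ := rfl
  map_smul' _ _ := rfl

/-- The pointwise limit of coherent lower previsions is coherent. -/
theorem IsCoherent.of_tendsto [Nonempty Ω] {ι : Type*} {l : Filter ι} [l.NeBot] {Q : ι → K → ℝ}
    (hQ : ∀ i, IsCoherent K (Q i)) (hlim : ∀ f, Tendsto (fun i => Q i f) l (𝓝 (P f))) :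
    IsCoherent K P where
  domain_le := by
    obtain ⟨i⟩ := l.nonempty_of_neBot
    exact (hQ i).domain_le
  iInf_le f := ge_of_tendsto (hlim f) (Eventually.of_forall fun i => (hQ i).iInf_le f)
  map_smul c f hc := tendsto_nhds_unique (hlim (c • f))
    (((hlim f).const_mul c).congr fun i => ((hQ i).map_smul c f hc).symm)
  le_map_add f g := le_of_tendsto_of_tendsto' ((hlim f).add (hlim g)) (hlim (f + g))
    fun i => (hQ i).le_map_add f g

end Coherence

/-! ### Multinomial previsions and counting. -/

section Multinomial

variable {X : Type*}

theorem mem_gambles_of_finite {Ω : Type*} [Finite Ω] (f : Ω → ℝ) : f ∈ gambles Ω := by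
  obtain ⟨C, hC⟩ := (Set.finite_range f).isBounded.exists_norm_le
  exact ⟨C, fun ω => hC _ ⟨ω, rfl⟩⟩

variable [Fintype X] [DecidableEq X]

theorem prod_pow_count {M : Type*} [CommMonoid M] {n : ℕ} (z : Fin n → X) (u : X → M) :
    ∏ x, u x ^ count z x = ∏ k, u (z k) := by
  rw [← Finset.prod_fiberwise' Finset.univ z u]
  simp [count]

theorem multinomialPrev_eq {n : ℕ} (f : gambles (Fin n → X)) (θ : stdSimplex ℝ X) :
    multinomialPrev f θ =
      ∑ z : Fin n → X, (f : (Fin n → X) → ℝ) z * ∏ k, (θ : X → ℝ) (z k) := by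
  simp only [multinomialPrev, prod_pow_count]

/-- The number of sequences with a given count vector is a multinomial coefficient. -/
theorem card_countMap_eq {n : ℕ} (m : CountVec X n) :
    (Finset.univ.filter fun z : Fin n → X => countMap n z = m).card =
      Nat.multinomial Finset.univ m.1 := by
  -- Compare two computations of the coefficient of the monomial `X^m` in `(∑ x, X x)^n`: the
  -- multinomial theorem, and expansion into words `z`.
  have h := MvPolynomial.coeff_sum_X_pow_of_fintype (R := ℕ) (Finsupp.equivFunOnFinite.symm m.1) n
  have h2 : (∑ x : X, MvPolynomial.X x : MvPolynomial X ℕ) ^ n =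
      ∑ z : Fin n → X, ∏ k, MvPolynomial.X (z k) := by
    have := Finset.prod_univ_sum (fun _ : Fin n => (Finset.univ : Finset X))
      (fun _ x => (MvPolynomial.X x : MvPolynomial X ℕ))
    simpa using this
  have h3 (z : Fin n → X) : MvPolynomial.coeff (Finsupp.equivFunOnFinite.symm m.1)
      (∏ k, MvPolynomial.X (z k) : MvPolynomial X ℕ) = if countMap n z = m then 1 else 0 := by
    rw [← prod_pow_count, MvPolynomial.coeff_prod_X_pow]
    congr 1
    simp only [eq_iff_iff, Subtype.ext_iff, countMap, Finsupp.ext_iff, funext_iff]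
    simp [Finsupp.indicator_apply, eq_comm]
  rw [h2, MvPolynomial.coeff_sum] at h
  simp only [h3] at h
  rw [Finset.sum_boole, Nat.cast_id] at h
  rw [h, if_pos]
  · exact (Finsupp.multinomial_of_support_subset (Finset.subset_univ (Finsupp.equivFunOnFinite.symm m.1).support)).symm
  · rw [Finsupp.sum_fintype _ _ (by simp)]
    simpa using m.2

/-- The summand depends on `z` only through its counts, so the sum collapses along the fibres of
`countMap`. The count formula thereby becomes a case of the multinomial one. -/
theorem multinomialPrev_pullback_countMap {n : ℕ} (g : gambles (CountVec X n)) :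
    multinomialPrev (pullback (countMap n) g) = countMultinomialPrev g := by
  funext θ
  rw [multinomialPrev, countMultinomialPrev, ← Finset.sum_fiberwise Finset.univ (countMap n)]
  refine Finset.sum_congr rfl fun m _ => ?_
  rw [← card_countMap_eq, Finset.sum_congr rfl (g := fun _ => (g : CountVec X n → ℝ) m *
    ∏ x, (θ : X → ℝ) x ^ m.1 x)]
  · rw [Finset.sum_const, nsmul_eq_mul]; ring
  · rintro z hz
    obtain rfl := (Finset.mem_filter.1 hz).2
    rfl

/-! ### Polynomials as multinomial previsions -/

/-- The function `p` on the simplex is the multinomial prevision of a gamble on `𝒳ⁿ`. -/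
def IsMultinomial (n : ℕ) (p : stdSimplex ℝ X → ℝ) : Prop :=
  ∃ f : gambles (Fin n → X), multinomialPrev f = p

theorem IsMultinomial.add {n : ℕ} {p q : stdSimplex ℝ X → ℝ} (hp : IsMultinomial n p)
    (hq : IsMultinomial n q) : IsMultinomial n (p + q) := by
  obtain ⟨f, rfl⟩ := hp
  obtain ⟨g, rfl⟩ := hq
  refine ⟨f + g, funext fun θ => ?_⟩
  simp [multinomialPrev, add_mul, Finset.sum_add_distrib]

/-- Disjoint blocks of draws are independent: apply one gamble to the first `n` draws, the other to
the last `m`, and multiply. -/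
theorem IsMultinomial.mul {n m : ℕ} {p q : stdSimplex ℝ X → ℝ} (hp : IsMultinomial n p)
    (hq : IsMultinomial m q) : IsMultinomial (n + m) (p * q) := by
  obtain ⟨f, rfl⟩ := hp
  obtain ⟨g, rfl⟩ := hq
  refine ⟨⟨fun z => f.1 (fun i => z (Fin.castAdd m i)) * g.1 (fun i => z (Fin.natAdd n i)),
    mem_gambles_of_finite _⟩, funext fun θ => ?_⟩
  simp only [multinomialPrev_eq, Pi.mul_apply, Finset.sum_mul_sum]
  rw [← Fintype.sum_prod_type', ← (Fin.appendEquiv n m).sum_comp]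
  refine Finset.sum_congr rfl fun z _ => ?_
  simp [Fin.prod_univ_add]
  ring

theorem isMultinomial_const (n : ℕ) (c : ℝ) :
    IsMultinomial n (fun _ : stdSimplex ℝ X => c) := by
  refine ⟨⟨fun _ => c, mem_gambles_of_finite _⟩, funext fun θ => ?_⟩
  have := Finset.prod_univ_sum (fun _ : Fin n => (Finset.univ : Finset X))
    (fun _ x => (θ : X → ℝ) x)
  simp only [Fintype.piFinset_univ] at this
  rw [multinomialPrev_eq, ← Finset.mul_sum, ← this]
  simp

theorem isMultinomial_coord (x : X) :
    IsMultinomial 1 (fun θ : stdSimplex ℝ X => (θ : X → ℝ) x) := by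
  refine ⟨⟨fun z => if z 0 = x then 1 else 0, mem_gambles_of_finite _⟩, funext fun θ => ?_⟩
  rw [multinomialPrev_eq, ← (Equiv.funUnique (Fin 1) X).symm.sum_comp]
  simp

theorem exists_multinomialPrev_eq {p : stdSimplex ℝ X → ℝ} (hp : p ∈ polynomialGambles X) :
    ∃ (n : ℕ+) (f : gambles (Fin n → X)), multinomialPrev f = p := by
  suffices h : ∃ n : ℕ, IsMultinomial n p by
    obtain ⟨n, h⟩ := h
    -- One ignored extra draw makes the sample size positive.
    obtain ⟨f, hf⟩ := h.mul (isMultinomial_const 1 1)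
    exact ⟨⟨n + 1, n.succ_pos⟩, f, hf.trans (mul_one p)⟩
  obtain ⟨q, hq⟩ := hp
  obtain rfl : p = fun θ : stdSimplex ℝ X => MvPolynomial.eval (θ : X → ℝ) q := funext hq
  clear hq
  induction q using MvPolynomial.induction_on with
  | C a => exact ⟨0, by simpa using isMultinomial_const 0 a⟩
  | add p q hp hq =>
    obtain ⟨n, hn⟩ := hp
    obtain ⟨m, hm⟩ := hq
    refine ⟨n + m, ?_⟩
    -- Multiplying by the constant 1 pads both summands to the common sample size `n + m`.
    convert (hn.mul (isMultinomial_const m 1)).add ((isMultinomial_const n 1).mul hm) using 1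
    funext θ
    simp
  | mul_X p x hp =>
    obtain ⟨n, hn⟩ := hp
    refine ⟨n + 1, ?_⟩
    convert hn.mul (isMultinomial_coord x) using 1
    funext θ
    simp

/-! ### Sampling with replacement -/

/-- The multinomial prevision at the frequency vector of `z ∈ 𝒳ᴺ` is the expectation under
uniform sampling with replacement from `z`. -/
theorem multinomialPrev_frequency {n : ℕ} (f : gambles (Fin n → X)) (N : ℕ+) (z : Fin N → X) :
    multinomialPrev f (frequency N z) =
      ((N : ℕ) ^ n : ℝ)⁻¹ * ∑ τ : Fin n → Fin N, (f : (Fin n → X) → ℝ) (z ∘ τ) := by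
  rw [multinomialPrev_eq, ← Finset.sum_fiberwise Finset.univ (fun τ : Fin n → Fin N => z ∘ τ),
    Finset.mul_sum]
  refine Finset.sum_congr rfl fun w _ => ?_
  -- To have `z ∘ τ = w`, each `τ k` is chosen independently among the positions where `z` takes the
  -- value `w k`.
  have hcard : (Finset.univ.filter fun τ : Fin n → Fin N => z ∘ τ = w).card =
      ∏ k, count z (w k) := by
    simp only [count]
    rw [← Fintype.card_piFinset]
    congr 1
    ext τ
    simp [funext_iff]
  rw [Finset.sum_congr rfl (g := fun _ => (f : (Fin n → X) → ℝ) w), Finset.sum_const, hcard,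
    nsmul_eq_mul]
  · have hfreq (x : X) : (frequency N z : X → ℝ) x = (count z x : ℝ) / (N : ℕ) := rfl
    simp only [hfreq, Finset.prod_div_distrib, Nat.cast_prod, Finset.prod_const, Finset.card_univ,
      Fintype.card_fin]
    ring
  · rintro τ hτ
    rw [(Finset.mem_filter.1 hτ).2]

end Multinomial

/-! ### Sampling without replacement -/

section Exchangeable

variable {X : Type*}

/-- Under exchangeability, all ways of drawing `n` distinct components of `(X₁, …, X_N)` are
indifferent. -/
theorem IsExchangeable.nonneg_of_injective {n N : ℕ} {P : gambles (Fin N → X) → ℝ}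
    (hP : IsExchangeable P) (f : gambles (Fin n → X)) {τ τ' : Fin n → Fin N}
    (hτ : Function.Injective τ) (hτ' : Function.Injective τ') :
    0 ≤ P (pullback (fun z : Fin N → X => z ∘ τ) f - pullback (fun z : Fin N → X => z ∘ τ') f) := by
  -- Some permutation `σ` of the `N` positions satisfies `σ ∘ τ' = τ`.
  obtain ⟨σ, hσ⟩ := Equiv.Perm.exists_extending_pair τ' τ hτ' hτ
  convert hP σ (pullback (fun z : Fin N → X => z ∘ τ') f) using 3
  ext z
  have : z ∘ τ = (z ∘ σ) ∘ τ' := funext fun i => congrArg z (hσ i).symm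
  simp [pullback, this]

/-- A bound for the lower prevision of an average over all maps `τ`, when the terms for
injective `τ` are acceptable. -/
theorem IsCoherent.le_map_average {Ω : Type*} [Nonempty Ω] {K : Submodule ℝ (Ω → ℝ)} {P : K → ℝ}
    (hP : IsCoherent K P) {n N : ℕ} (hN : N ≠ 0) {C : ℝ} (D : (Fin n → Fin N) → K)
    (hD : ∀ τ ω, -C ≤ (D τ : Ω → ℝ) ω) (hinj : ∀ τ, Function.Injective τ → 0 ≤ P (D τ)) :
    -(C * (1 - (N.descFactorial n : ℝ) / N ^ n)) ≤ P (((N : ℝ) ^ n)⁻¹ • ∑ τ, D τ) := by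
  classical
  rw [hP.map_smul _ _ (by positivity)]
  have hpos : (0 : ℝ) < (N : ℝ) ^ n := by positivity
  have hcard : (Finset.univ.filter fun τ : Fin n → Fin N => Function.Injective τ).card =
      N.descFactorial n := by
    rw [← Fintype.card_subtype,
      Fintype.card_congr (Equiv.subtypeInjectiveEquivEmbedding (Fin n) (Fin N)),
      Fintype.card_embedding_eq, Fintype.card_fin, Fintype.card_fin]
  -- The summand on the left is 0 for injective `τ` and the trivial bound `-C` otherwise.
  have h1 : ∑ τ : Fin n → Fin N, ((if Function.Injective τ then C else 0) - C) ≤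
      ∑ τ, P (D τ) := by
    refine Finset.sum_le_sum fun τ _ => ?_
    split_ifs with h
    · simpa using hinj τ h
    · simpa using hP.le_of_forall_le (hD τ)
  have h2 := h1.trans (hP.sum_le_map_sum Finset.univ D)
  rw [Finset.sum_sub_distrib, ← Finset.sum_filter, Finset.sum_const, Finset.sum_const, hcard,
    Finset.card_univ, Fintype.card_fun, Fintype.card_fin, Fintype.card_fin, nsmul_eq_mul,
    nsmul_eq_mul, Nat.cast_pow] at h2
  calc -(C * (1 - (N.descFactorial n : ℝ) / N ^ n))
      = ((N : ℝ) ^ n)⁻¹ * (N.descFactorial n * C - N ^ n * C) := by field_simp; ring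
    _ ≤ _ := by gcongr

theorem tendsto_descFactorial_div_pow (n : ℕ) :
    Tendsto (fun N : ℕ => (N.descFactorial n : ℝ) / N ^ n) atTop (𝓝 1) := by
  refine (Asymptotics.isEquivalent_iff_tendsto_one ?_).1 (isEquivalent_descFactorial n)
  filter_upwards [eventually_ne_atTop 0] with N hN
  positivity

end Exchangeable

/-! ### Polynomial and continuous gambles -/

section Simplex

variable {X : Type*} [Fintype X]

/-- Stone–Weierstrass on the compact simplex: the coordinate functions separate points. -/
theorem exists_polynomialGambles_near {h : stdSimplex ℝ X → ℝ} (hh : Continuous h) {ε : ℝ}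
    (hε : 0 < ε) : ∃ p : polynomialGambles X, ∀ θ, |h θ - (p : stdSimplex ℝ X → ℝ) θ| ≤ ε := by
  let φ : MvPolynomial X ℝ →ₐ[ℝ] C(stdSimplex ℝ X, ℝ) :=
    MvPolynomial.aeval fun x => ⟨fun θ => (θ : X → ℝ) x,
      (continuous_apply x).comp continuous_subtype_val⟩
  have hφ (q : MvPolynomial X ℝ) (θ : stdSimplex ℝ X) :
      φ q θ = MvPolynomial.eval (θ : X → ℝ) q := by
    induction q using MvPolynomial.induction_on with
    | C a => simp [φ]
    | add p q hp hq => simp [hp, hq]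
    | mul_X p x hp => simp [hp]; simp [φ]
  have hsep : φ.range.SeparatesPoints := by
    intro θ θ' hne
    obtain ⟨x, hx⟩ : ∃ x, (θ : X → ℝ) x ≠ (θ' : X → ℝ) x := by
      by_contra! hall
      exact hne (Subtype.ext (funext hall))
    exact ⟨φ (MvPolynomial.X x), ⟨φ (MvPolynomial.X x), ⟨_, rfl⟩, rfl⟩, by simpa [hφ] using hx⟩
  obtain ⟨⟨_, q, rfl⟩, hg⟩ :=
    ContinuousMap.exists_mem_subalgebra_near_continuous_of_separatesPoints φ.range hsep h hh ε hε
  refine ⟨⟨fun θ => MvPolynomial.eval (θ : X → ℝ) q, q, fun _ => rfl⟩, fun θ => ?_⟩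
  rw [abs_sub_comm]
  simpa [hφ] using (hg θ).le

/-- A coherent lower prevision on `𝓥(Σ)` has at most one coherent extension to `𝓒(Σ)`. -/
theorem IsCoherentExtension.unique [DecidableEq X] [Nonempty X] {R : polynomialGambles X → ℝ}
    {E E' : continuousGambles (stdSimplex ℝ X) → ℝ} (hE : IsCoherentExtension R E)
    (hE' : IsCoherentExtension R E') : E = E' := by
  funext h
  refine eq_of_forall_dist_le fun ε hε => ?_
  obtain ⟨p, hp⟩ := exists_polynomialGambles_near h.2.1 (half_pos hε)
  have h1 := hE.coherent.abs_sub_le (f := h) (g := ⟨p.1, polynomialGambles_le X p.2⟩) hp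
  have h2 := hE'.coherent.abs_sub_le (f := h) (g := ⟨p.1, polynomialGambles_le X p.2⟩) hp
  rw [hE.extend] at h1
  rw [hE'.extend] at h2
  rw [Real.dist_eq]
  rw [abs_le] at *
  constructor <;> linarith

/-- The inclusion of the continuous gambles into the gambles. -/
def continuousGamblesInclusion (S : Type*) [TopologicalSpace S] :
    continuousGambles S →ₗ[ℝ] gambles S :=
  Submodule.inclusion (continuousGambles_le S)

end Simplex

/-! ### The representing lower prevision -/

section Representation

variable {X : Type*} [Fintype X] [DecidableEq X]

theorem IsRepresentation.unique {P : ∀ n : ℕ+, gambles (Fin n → X) → ℝ}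
    {R R' : polynomialGambles X → ℝ} (hR : IsRepresentation P R) (hR' : IsRepresentation P R') :
    R = R' := by
  funext p
  obtain ⟨n, f, hf⟩ := exists_multinomialPrev_eq p.2
  obtain rfl : p = ⟨multinomialPrev f, multinomialPrev_mem f⟩ := Subtype.ext hf.symm
  rw [← hR.eq_multinomial, ← hR'.eq_multinomial]

/-- The distribution of the frequency random variable `Fₙ`, restricted to continuous gambles. -/
def frequencyPrev (P : ∀ n : ℕ+, gambles (Fin n → X) → ℝ) (n : ℕ+)
    (h : continuousGambles (stdSimplex ℝ X)) : ℝ :=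
  induced (P n) (frequency n) ⟨(h : stdSimplex ℝ X → ℝ), continuousGambles_le _ h.2⟩

variable [Nonempty X] {P : ∀ n : ℕ+, gambles (Fin n → X) → ℝ}

theorem isCoherent_frequencyPrev (hcoh : ∀ n : ℕ+, IsCoherent (gambles (Fin n → X)) (P n))
    (n : ℕ+) : IsCoherent (continuousGambles (stdSimplex ℝ X)) (frequencyPrev P n) :=
  (hcoh n).comp_linearMap (continuousGambles_le _)
    (pullbackLinear (frequency n) ∘ₗ continuousGamblesInclusion _) fun _ ω => ⟨frequency n ω, rfl⟩

/-- The error made when sampling with replacement instead of without replacement. -/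
theorem abs_frequencyPrev_multinomialPrev_sub_le
    (hcoh : ∀ n : ℕ+, IsCoherent (gambles (Fin n → X)) (P n))
    (hexch : ∀ n : ℕ+, IsExchangeable (P n)) (hcons : TimeConsistent P) {n N : ℕ+} (hnN : n ≤ N)
    (f : gambles (Fin n → X)) {C : ℝ} (hC : ∀ z, |(f : (Fin n → X) → ℝ) z| ≤ C) :
    |frequencyPrev P N ⟨multinomialPrev f, polynomialGambles_le X (multinomialPrev_mem f)⟩ - P n f|
      ≤ 2 * C * (1 - ((N : ℕ).descFactorial n : ℝ) / (N : ℕ) ^ (n : ℕ)) := by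
  let F (τ : Fin n → Fin N) : gambles (Fin N → X) := pullback (fun z : Fin N → X => z ∘ τ) f
  let ι : Fin n → Fin N := Fin.castLE hnN
  have hι : Function.Injective ι := Fin.castLE_injective hnN
  have hN : ((N : ℕ) : ℝ) ^ (n : ℕ) ≠ 0 := pow_ne_zero _ (Nat.cast_ne_zero.2 N.pos.ne')
  have hF (τ τ' : Fin n → Fin N) (z : Fin N → X) :
      -(2 * C) ≤ ((F τ - F τ' : gambles (Fin N → X)) : (Fin N → X) → ℝ) z := by
    have h1 := (abs_le.1 (hC (z ∘ τ))).1
    have h2 := (abs_le.1 (hC (z ∘ τ'))).2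
    change -(2 * C) ≤ f.1 (z ∘ τ) - f.1 (z ∘ τ')
    linarith
  set M : gambles (Fin N → X) := pullback (frequency N)
    ⟨multinomialPrev f, continuousGambles_le _ (polynomialGambles_le X (multinomialPrev_mem f))⟩
  have hM : M = (((N : ℕ) : ℝ) ^ (n : ℕ))⁻¹ • ∑ τ, F τ := by
    ext z
    refine (multinomialPrev_frequency f N z).trans ?_
    simp [F, pullback]
  -- Written as an average of copies of itself, `F ι` can be subtracted from `M` term by term.
  have hι' : F ι = (((N : ℕ) : ℝ) ^ (n : ℕ))⁻¹ • ∑ τ : Fin n → Fin N, F ι := by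
    rw [Finset.sum_const, Finset.card_univ, Fintype.card_fun, Fintype.card_fin, Fintype.card_fin,
      ← Nat.cast_smul_eq_nsmul ℝ, smul_smul, Nat.cast_pow, inv_mul_cancel₀ hN, one_smul]
  have hPn : P n f = P N (F ι) := hcons n N hnN f
  -- `P N` is only superadditive, so `M - F ι` and `F ι - M` each need their own lower bound.
  have h1 := (hcoh N).le_map_average N.pos.ne' (fun τ => F τ - F ι) (fun τ => hF τ ι)
    fun τ hτ => (hexch N).nonneg_of_injective f hτ hι
  have h2 := (hcoh N).le_map_average N.pos.ne' (fun τ => F ι - F τ) (fun τ => hF ι τ)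
    fun τ hτ => (hexch N).nonneg_of_injective f hι hτ
  rw [Finset.sum_sub_distrib, smul_sub, ← hM, ← hι'] at h1 h2
  have h3 := (hcoh N).map_add_map_sub_le (F ι) M
  have h4 := (hcoh N).map_add_map_sub_le M (F ι)
  change |P N M - P n f| ≤ _
  rw [hPn, abs_le]
  constructor <;> linarith

theorem tendsto_frequencyPrev_multinomialPrev
    (hcoh : ∀ n : ℕ+, IsCoherent (gambles (Fin n → X)) (P n))
    (hexch : ∀ n : ℕ+, IsExchangeable (P n)) (hcons : TimeConsistent P) {n : ℕ+}
    (f : gambles (Fin n → X)) :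
    Tendsto (fun N => frequencyPrev P N
      ⟨multinomialPrev f, polynomialGambles_le X (multinomialPrev_mem f)⟩) atTop (𝓝 (P n f)) := by
  obtain ⟨C, hC⟩ := f.2
  rw [tendsto_iff_norm_sub_tendsto_zero]
  have hlim : Tendsto (fun N : ℕ+ =>
      2 * C * (1 - ((N : ℕ).descFactorial n : ℝ) / (N : ℕ) ^ (n : ℕ))) atTop (𝓝 0) := by
    have := (((tendsto_descFactorial_div_pow n).comp
      tendsto_PNat_val_atTop_atTop).const_sub 1).const_mul (2 * C)
    simpa using this
  refine squeeze_zero' (Eventually.of_forall fun _ => norm_nonneg _) ?_ hlim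
  filter_upwards [eventually_ge_atTop n] with N hN
  exact abs_frequencyPrev_multinomialPrev_sub_le hcoh hexch hcons hN f hC

theorem exists_tendsto_frequencyPrev
    (hcoh : ∀ n : ℕ+, IsCoherent (gambles (Fin n → X)) (P n))
    (hexch : ∀ n : ℕ+, IsExchangeable (P n)) (hcons : TimeConsistent P)
    (h : continuousGambles (stdSimplex ℝ X)) :
    ∃ a, Tendsto (fun N => frequencyPrev P N h) atTop (𝓝 a) := by
  refine cauchySeq_tendsto_of_complete (Metric.cauchySeq_iff.2 fun ε hε => ?_)
  -- Two approximation errors and one Cauchy error, each at most `ε / 4`, stay strictly below `ε`.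
  obtain ⟨p, hp⟩ := exists_polynomialGambles_near h.2.1 (show 0 < ε / 4 by positivity)
  obtain ⟨n, f, hf⟩ := exists_multinomialPrev_eq p.2
  obtain rfl : p = ⟨multinomialPrev f, multinomialPrev_mem f⟩ := Subtype.ext hf.symm
  obtain ⟨N₀, hN₀⟩ := Metric.cauchySeq_iff.1
    (tendsto_frequencyPrev_multinomialPrev hcoh hexch hcons f).cauchySeq (ε / 4) (by positivity)
  refine ⟨N₀, fun N hN N' hN' => ?_⟩
  have h0 := hN₀ N hN N' hN'
  have h1 (N : ℕ+) := (isCoherent_frequencyPrev hcoh N).abs_sub_le (f := h)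
    (g := ⟨multinomialPrev f, polynomialGambles_le X (multinomialPrev_mem f)⟩) hp
  have h2 := abs_le.1 (h1 N)
  have h3 := abs_le.1 (h1 N')
  rw [Real.dist_eq, abs_lt] at *
  constructor <;> linarith

theorem exists_isRepresentation_isCoherentExtension
    (hcoh : ∀ n : ℕ+, IsCoherent (gambles (Fin n → X)) (P n))
    (hexch : ∀ n : ℕ+, IsExchangeable (P n)) (hcons : TimeConsistent P) :
    ∃ (R : polynomialGambles X → ℝ) (E : continuousGambles (stdSimplex ℝ X) → ℝ),
      IsRepresentation P R ∧ IsCoherentExtension R E ∧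
        ∀ h, Tendsto (fun N => frequencyPrev P N h) atTop (𝓝 (E h)) := by
  choose E hE using exists_tendsto_frequencyPrev hcoh hexch hcons
  have hEcoh : IsCoherent _ E := .of_tendsto (isCoherent_frequencyPrev hcoh) hE
  have hmult (n : ℕ+) (f : gambles (Fin n → X)) :
      P n f = E ⟨multinomialPrev f, polynomialGambles_le X (multinomialPrev_mem f)⟩ :=
    tendsto_nhds_unique (tendsto_frequencyPrev_multinomialPrev hcoh hexch hcons f) (hE _)
  refine ⟨fun p => E ⟨p.1, polynomialGambles_le X p.2⟩, E, ⟨?_, hmult, fun n g => ?_⟩,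
    ⟨hEcoh, fun _ => rfl⟩, hE⟩
  · exact hEcoh.comp_linearMap ((polynomialGambles_le X).trans (continuousGambles_le _))
      (Submodule.inclusion (polynomialGambles_le X)) fun _ ω => ⟨ω, rfl⟩
  · rw [induced, hmult]
    simp only [multinomialPrev_pullback_countMap]

end Representation

end LowerPrevision

end

open LowerPrevision in
theorem theorem6 {X : Type*} [Fintype X] [DecidableEq X] [Nonempty X]
    (P : ∀ n : ℕ+, gambles (Fin n → X) → ℝ)
    (hcoh : ∀ n : ℕ+, IsCoherent (gambles (Fin n → X)) (P n))
    (hexch : ∀ n : ℕ+, IsExchangeable (P n))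
    (hcons : TimeConsistent P) :
    (∃! R : polynomialGambles X → ℝ, IsRepresentation P R) ∧
      ∀ R : polynomialGambles X → ℝ, IsRepresentation P R →
        (∃! E : continuousGambles (stdSimplex ℝ X) → ℝ, IsCoherentExtension R E) ∧
          ∀ E : continuousGambles (stdSimplex ℝ X) → ℝ, IsCoherentExtension R E →
            ∀ h : continuousGambles (stdSimplex ℝ X),
              Tendsto
                (fun n : ℕ+ =>
                  induced (P n) (frequency n)
                    ⟨(h : stdSimplex ℝ X → ℝ), continuousGambles_le _ h.2⟩)
                atTop (𝓝 (E h)) := by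
  obtain ⟨R₀, E₀, hR₀, hE₀, hlim⟩ := exists_isRepresentation_isCoherentExtension hcoh hexch hcons
  refine ⟨⟨R₀, hR₀, fun R hR => hR.unique hR₀⟩, fun R hR => ?_⟩
  obtain rfl := hR.unique hR₀
  refine ⟨⟨E₀, hE₀, fun E hE => hE.unique hE₀⟩, fun E hE h => ?_⟩
  obtain rfl := hE.unique hE₀
  exact hlim h
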